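/- Let $X$ be a finite biquandle: a finite set with two binary operations $\,\underline{\triangleright}\,,\,\overline{\triangleright}\,$ such that $x\,\underline{\triangleright}\,x=x\,\overline{\triangleright}\,x$ for all $x$; the maps $x\mapsto x\,\overline{\triangleright}\,y$, $x\mapsto x\,\underline{\triangleright}\,y$ (for every $y$) and $(x,y)\mapsto(y\,\overline{\triangleright}\,x,\ x\,\underline{\triangleright}\,y)$ are bijective; and for all $x,y,z$ $$(x\,\underline{\triangleright}\,y)\,\underline{\triangleright}\,(z\,\underline{\triangleright}\,y)=(x\,\underline{\triangleright}\,z)\,\underline{\triangleright}\,(y\,\overline{\triangleright}\,z),\quad (x\,\underline{\triangleright}\,y)\,\overline{\triangleright}\,(z\,\underline{\triangleright}\,y)=(x\,\overline{\triangleright}\,z)\,\underline{\triangleright}\,(y\,\overline{\triangleright}\,z),\quad (x\,\overline{\triangleright}\,y)\,\overline{\triangleright}\,(z\,\overline{\triangleright}\,y)=(x\,\overline{\triangleright}\,z)\,\overline{\triangleright}\,(y\,\underline{\triangleright}\,z).$$ Let $A$ be an abelian group and $\phi:X^2\to A$ a function. Let $D$ be an oriented classical or virtual link diagram. Its semiarcs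 run from one classical crossing to the next (virtual crossings do not interrupt them), or are closed components without classical crossings. An $X$-coloring of $D$ assigns an element of $X$ to every semiarc such that at each positive crossing, for some $x,y\in X$, the under strand changes from $x$ to $x\,\underline{\triangleright}\,y$ and the over strand from $y\,\overline{\triangleright}\,x$ to $y$, and at each negative crossing, for some $x,y\in X$, the under strand changes from $x\,\underline{\triangleright}\,y$ to $x$ and the over strand from $y$ to $y\,\overline{\triangleright}\,x$. A route of order $2$ is a pair of semiarcs such that the first one ends at the classical crossing where the second one starts; it is a through route if it continues along the same strand at this crossing, and a crooked route if it turns to the other strand. For a type (complete, through or crooked), let $R$ be the set of all routes, of all through routes, or of all crooked routes of order $2$, respectively. The total fare of an $X$-coloring $f$ is $\sum_{(e_1,e_2)\in R}\pm\phi(f(e_1),f(e_2))\in A$, where the sign is the sign of the crossing between $e_1$ and $e_2$. For $x,y\in X$ put - complete type: $w(x,y)=\phi(x,y)+\phi(x,x\,\underline{\triangleright}\,y)+\phi(y\,\overline{\triangleright}\,x,y)+\phi(y\,\overline{\triangleright}\,x,x\,\underline{\triangleright}\,y)$ and $\bar w(x,y)=\phi(y,x)+\phi(x\,\underline{\triangleright}\,y,x)+\phi(y,y\,\overline{\triangleright}\,x)+\phi(x\,\underline{\triangleright}\,y,y\,\overline{\triangleright}\,x)$;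 - through type: $w(x,y)=\phi(x,x\,\underline{\triangleright}\,y)+\phi(y\,\overline{\triangleright}\,x,y)$ and $\bar w(x,y)=\phi(x\,\underline{\triangleright}\,y,x)+\phi(y,y\,\overline{\triangleright}\,x)$; - crooked type: $w(x,y)=\phi(x,y)+\phi(y\,\overline{\triangleright}\,x,x\,\underline{\triangleright}\,y)$ and $\bar w(x,y)=\phi(y,x)+\phi(x\,\underline{\triangleright}\,y,y\,\overline{\triangleright}\,x)$. The function $\phi$ is a (complete, through or crooked) biquandle $2$-fare if, with the $w,\bar w$ of this type, for all $x,y,z\in X$: (i) $w(x,x)=0$; explicitly, $\phi(x,x)+\phi(x,x\,\underline{\triangleright}\,x)+\phi(x\,\underline{\triangleright}\,x,x)+\phi(x\,\underline{\triangleright}\,x,x\,\underline{\triangleright}\,x)=0$ for the complete, $\phi(x,x\,\underline{\triangleright}\,x)+\phi(x\,\underline{\triangleright}\,x,x)=0$ for the through, and $\phi(x,x)+\phi(x\,\underline{\triangleright}\,x,x\,\underline{\triangleright}\,x)=0$ for the crooked type; (ii) $w(x,y)-\bar w(x,y)=0$; (iii) $w(x,y)+w(y,z)+w(x\,\underline{\triangleright}\,y,z\,\overline{\triangleright}\,y)=w(x,z)+w(y\,\overline{\triangleright}\,x,z\,\overline{\triangleright}\,x)+w(x\,\underline{\triangleright}\,z,y\,\underline{\triangleright}\,z)$.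 **Theorem.** If $\phi$ is a complete, through or crooked biquandle $2$-fare, then the multiset of the total fares (of this type) of all $X$-colorings of $D$ is invariant under Reidemeister moves: two oriented classical or virtual link diagrams related by (generalized, oriented) Reidemeister moves have the same multiset. -/

import Mathlib

/-! ### Biquandles -/

/-- A biquandle: a set with two binary operations `underOp x y`, written `x ▿ y` (an underlined
triangle in the literature), and `overOp x y`, written `x ▵ y` (an overlined triangle). -/
class Biquandle (X : Type*) where
  underOp : X → X → X
  overOp : X → X → X
  under_self : ∀ x, underOp x x = overOp x x
  over_bijective : ∀ y, Function.Bijective (fun x => overOp x y)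
  under_bijective : ∀ y, Function.Bijective (fun x => underOp x y)
  switch_bijective : Function.Bijective (fun p : X × X => (overOp p.2 p.1, underOp p.1 p.2))
  exchange₁ : ∀ x y z, underOp (underOp x y) (underOp z y) = underOp (underOp x z) (overOp y z)
  exchange₂ : ∀ x y z, overOp (underOp x y) (underOp z y) = underOp (overOp x z) (overOp y z)
  exchange₃ : ∀ x y z, overOp (overOp x y) (overOp z y) = overOp (overOp x z) (underOp y z)

infixl:70 " ▿ " => Biquandle.underOp
infixl:70 " ▵ " => Biquandle.overOp

/-! ### Oriented classical and virtual link diagrams -/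

/-- The two strands at a classical crossing. -/
inductive Strand where
  | upper
  | lower
  deriving DecidableEq

instance : Fintype Strand := ⟨{.upper, .lower}, fun s => by cases s <;> simp⟩

/-- An oriented virtual link diagram, given by its Gauss diagram: the classical crossings with
their signs, the semiarcs, and for each strand of each crossing the semiarc that arrives along that
strand (`inc`) and the semiarc that leaves along it (`out`). A semiarc runs from one classical
crossing to the next; virtual crossings do not interrupt it. The conditions say that every semiarc
either starts at exactly one strand of a crossing and ends at exactly one strand of a crossing, or
is a closed component which meets no classical crossing. The diagrams of classical links are those
that can be drawn in the plane without virtual crossings; planar isotopies and the moves that involve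
virtual crossings (the detour moves) leave these data unchanged. -/
structure LinkDiagram where
  Crossing : Type
  Semiarc : Type
  [fintypeCrossing : Fintype Crossing]
  [fintypeSemiarc : Fintype Semiarc]
  sign : Crossing → ℤˣ
  inc : Crossing × Strand → Semiarc
  out : Crossing × Strand → Semiarc
  inc_injective : Function.Injective inc
  out_injective : Function.Injective out
  range_inc_eq : Set.range inc = Set.range out

attribute [instance] LinkDiagram.fintypeCrossing LinkDiagram.fintypeSemiarc

namespace LinkDiagram

/-! ### Reidemeister moves -/

/-- `D` and `D'` are the same diagram up to renaming of crossings and semiarcs. -/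
def Iso (D D' : LinkDiagram) : Prop :=
  ∃ (κ : D.Crossing ≃ D'.Crossing) (τ : D.Semiarc ≃ D'.Semiarc),
    (∀ c, D'.sign (κ c) = D.sign c) ∧
    (∀ c s, D'.inc (κ c, s) = τ (D.inc (c, s))) ∧
    (∀ c s, D'.out (κ c, s) = τ (D.out (c, s)))

/-- `D` is obtained from `D'` by removing the crossings in `S` (as chords of the Gauss diagram) while
keeping all strands: two semiarcs of `D'` are parts of one semiarc of `D` iff they are connected by
passing straight through crossings in `S`. -/
def IsErasure (D' : LinkDiagram) (S : Set D'.Crossing) (D : LinkDiagram) : Prop :=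
  ∃ (κ : D.Crossing → D'.Crossing) (π : D'.Semiarc → D.Semiarc),
    Function.Injective κ ∧ Set.range κ = Sᶜ ∧
    Function.Surjective π ∧
    (∀ e e', π e = π e' ↔
      Relation.EqvGen (fun a b => ∃ c ∈ S, ∃ s, a = D'.inc (c, s) ∧ b = D'.out (c, s)) e e') ∧
    (∀ c, D'.sign (κ c) = D.sign c) ∧
    (∀ c s, D.inc (c, s) = π (D'.inc (κ c, s))) ∧
    (∀ c s, D.out (c, s) = π (D'.out (κ c, s)))

/-- The four oriented Reidemeister moves of type I: `D'` has a kink (a crossing of either sign such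
that the semiarc leaving it along one of its strands returns at once along the other one), and `D` is
`D'` with the kink removed. -/
def MoveI (D D' : LinkDiagram) : Prop :=
  ∃ c : D'.Crossing,
    (D'.out (c, .upper) = D'.inc (c, .lower) ∨ D'.out (c, .lower) = D'.inc (c, .upper)) ∧
    IsErasure D' {c} D

/-- The four oriented Reidemeister moves of type II: `D'` has two crossings of opposite sign, which
the over strand passes one right after the other, and the under strand passes one right after the
other, in the same order (strands with parallel orientations) or in the opposite order (strands with
antiparallel orientations); `D` is `D'` with these crossings removed. -/
def MoveII (D D' : LinkDiagram) : Prop :=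
  ∃ c d : D'.Crossing, c ≠ d ∧ D'.sign d = -D'.sign c ∧
    D'.out (c, .upper) = D'.inc (d, .upper) ∧
    (D'.out (c, .lower) = D'.inc (d, .lower) ∨ D'.out (d, .lower) = D'.inc (c, .lower)) ∧
    IsErasure D' {c, d} D

/-- The passages `p`, `q` in this order if `a = 1`, and in the opposite order if `a = -1`. -/
def inOrder {P : Type*} (a : ℤˣ) (p q : P) : P × P := if a = 1 then (p, q) else (q, p)

/-- In `D` a strand makes the passages `r.1` and `r.2` in this order, one right after the other; in
`D'` it makes them in the opposite order, with the same semiarcs (under the correspondences `κ`, `τ`)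
before, between and after them. -/
def Swapped {D D' : LinkDiagram} (κ : D.Crossing ≃ D'.Crossing) (τ : D.Semiarc ≃ D'.Semiarc)
    (r : (D.Crossing × Strand) × (D.Crossing × Strand)) : Prop :=
  D.out r.1 = D.inc r.2 ∧
  D'.inc (κ r.2.1, r.2.2) = τ (D.inc r.1) ∧
  D'.out (κ r.2.1, r.2.2) = τ (D.out r.1) ∧
  D'.inc (κ r.1.1, r.1.2) = τ (D.out r.1) ∧
  D'.out (κ r.1.1, r.1.2) = τ (D.out r.2)

/-- The eight oriented Reidemeister moves of type III. A top, a middle and a bottom strand bound a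
triangle with the vertices `tm` (top over middle), `mb` (middle over bottom) and `tb` (top over
bottom); the move carries one strand across the opposite vertex, which reverses the order of the two
crossings on each of the three strands. Here `ε` is `1` iff the top, middle and bottom sides follow one
another counterclockwise around the triangle, and `a`, `b`, `c` are `1` iff the top, middle, bottom
strand runs in the cyclic direction top side, middle side, bottom side around the triangle. The signs
of the crossings are those of such a triangle in the plane. -/
def MoveIII (D D' : LinkDiagram) : Prop :=
  ∃ (κ : D.Crossing ≃ D'.Crossing) (τ : D.Semiarc ≃ D'.Semiarc)
    (tm mb tb : D.Crossing) (ε a b c : ℤˣ),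
    tm ≠ mb ∧ mb ≠ tb ∧ tb ≠ tm ∧
    D.sign tm = ε * a * b ∧ D.sign mb = ε * b * c ∧ D.sign tb = -(ε * a * c) ∧
    (∀ x, D'.sign (κ x) = D.sign x) ∧
    Swapped κ τ (inOrder a (tb, .upper) (tm, .upper)) ∧
    Swapped κ τ (inOrder b (tm, .lower) (mb, .upper)) ∧
    Swapped κ τ (inOrder c (mb, .lower) (tb, .lower)) ∧
    (∀ x s, x ≠ tm → x ≠ mb → x ≠ tb →
      D'.inc (κ x, s) = τ (D.inc (x, s)) ∧ D'.out (κ x, s) = τ (D.out (x, s)))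

/-- Two diagrams represent the same oriented virtual link: they are related by a finite sequence of
Reidemeister moves and their inverses. -/
def ReidemeisterEquiv : LinkDiagram → LinkDiagram → Prop :=
  Relation.EqvGen (fun D D' => Iso D D' ∨ MoveI D D' ∨ MoveII D D' ∨ MoveIII D D')

/-! ### Colorings, routes and fares -/

/-- `f` is a biquandle coloring of the diagram. At a positive crossing, the under strand changes from
`x` to `x ▿ y` and the over strand from `y ▵ x` to `y`; at a negative crossing, the under strand
changes from `x ▿ y` to `x` and the over strand from `y` to `y ▵ x`. -/
def IsColoring {X : Type*} [Biquandle X] (D : LinkDiagram) (f : D.Semiarc → X) : Prop :=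
  ∀ c, (D.sign c = 1 →
      f (D.out (c, .lower)) = f (D.inc (c, .lower)) ▿ f (D.out (c, .upper)) ∧
      f (D.inc (c, .upper)) = f (D.out (c, .upper)) ▵ f (D.inc (c, .lower))) ∧
    (D.sign c = -1 →
      f (D.inc (c, .lower)) = f (D.out (c, .lower)) ▿ f (D.inc (c, .upper)) ∧
      f (D.out (c, .upper)) = f (D.inc (c, .upper)) ▵ f (D.out (c, .lower)))

/-- A route of order 2: a crossing, the strand along which its first semiarc arrives there and the
strand along which its second semiarc leaves. -/
abbrev Route (D : LinkDiagram) := D.Crossing × Strand × Strand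

namespace Route

variable {D : LinkDiagram}

def first (r : D.Route) : D.Semiarc := D.inc (r.1, r.2.1)

def second (r : D.Route) : D.Semiarc := D.out (r.1, r.2.2)

/-- Routes of order 2 are just the pairs of semiarcs such that the first one ends at the crossing
where the second one starts. -/
theorem injective : Function.Injective (fun r : D.Route => (r.first, r.second)) := by
  rintro ⟨c, s, t⟩ ⟨c', s', t'⟩ h
  have h₁ := D.inc_injective (congrArg Prod.fst h)
  have h₂ := D.out_injective (congrArg Prod.snd h)
  simp_all

end Route

end LinkDiagram

/-- The three types of fares of order 2. -/
inductive FareType where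
  | complete
  | through
  | crooked

/-- The routes that contribute to a fare of the given type: all routes; the routes that continue along
their strand at the crossing; the routes that turn at the crossing. -/
def FareType.Admits {D : LinkDiagram} : FareType → D.Route → Prop
  | complete, _ => True
  | through, r => r.2.1 = r.2.2
  | crooked, r => r.2.1 ≠ r.2.2

section Fares

variable {X A : Type*} [Biquandle X] [AddCommGroup A]

structure IsCompleteFare (φ : X × X → A) : Prop where
  ax₁ : ∀ x, φ (x, x) + φ (x, x ▿ x) + φ (x ▿ x, x) + φ (x ▿ x, x ▿ x) = 0
  ax₂ : ∀ x y, φ (x, y) + φ (x, x ▿ y) + φ (y ▵ x, y) + φ (y ▵ x, x ▿ y)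
    - φ (y, x) - φ (x ▿ y, x) - φ (y, y ▵ x) - φ (x ▿ y, y ▵ x) = 0
  ax₃ : ∀ x y z,
    φ (x, y) + φ (x, x ▿ y) + φ (y ▵ x, y) + φ (y ▵ x, x ▿ y)
    + φ (y, z) + φ (y, y ▿ z) + φ (z ▵ y, z) + φ (z ▵ y, y ▿ z)
    + φ (x ▿ y, z ▵ y) + φ (x ▿ y, (x ▿ y) ▿ (z ▵ y))
    + φ ((z ▵ y) ▵ (x ▿ y), z ▵ y) + φ ((z ▵ y) ▵ (x ▿ y), (x ▿ y) ▿ (z ▵ y))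
    = φ (x, z) + φ (x, x ▿ z) + φ (z ▵ x, z) + φ (z ▵ x, x ▿ z)
    + φ (y ▵ x, z ▵ x) + φ (y ▵ x, (y ▵ x) ▿ (z ▵ x))
    + φ ((z ▵ x) ▵ (y ▵ x), z ▵ x) + φ ((z ▵ x) ▵ (y ▵ x), (y ▵ x) ▿ (z ▵ x))
    + φ (x ▿ z, y ▿ z) + φ (x ▿ z, (x ▿ z) ▿ (y ▿ z))
    + φ ((y ▿ z) ▵ (x ▿ z), y ▿ z) + φ ((y ▿ z) ▵ (x ▿ z), (x ▿ z) ▿ (y ▿ z))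

structure IsThroughFare (φ : X × X → A) : Prop where
  ax₁ : ∀ x, φ (x, x ▿ x) + φ (x ▿ x, x) = 0
  ax₂ : ∀ x y, φ (x, x ▿ y) + φ (y ▵ x, y) - φ (x ▿ y, x) - φ (y, y ▵ x) = 0
  ax₃ : ∀ x y z,
    φ (x, x ▿ y) + φ (y ▵ x, y) + φ (y, y ▿ z) + φ (z ▵ y, z)
    + φ (x ▿ y, (x ▿ y) ▿ (z ▵ y)) + φ ((z ▵ y) ▵ (x ▿ y), z ▵ y)
    = φ (x, x ▿ z) + φ (z ▵ x, z)
    + φ (y ▵ x, (y ▵ x) ▿ (z ▵ x)) + φ ((z ▵ x) ▵ (y ▵ x), z ▵ x)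
    + φ (x ▿ z, (x ▿ z) ▿ (y ▿ z)) + φ ((y ▿ z) ▵ (x ▿ z), y ▿ z)

structure IsCrookedFare (φ : X × X → A) : Prop where
  ax₁ : ∀ x, φ (x, x) + φ (x ▿ x, x ▿ x) = 0
  ax₂ : ∀ x y, φ (x, y) + φ (y ▵ x, x ▿ y) - φ (y, x) - φ (x ▿ y, y ▵ x) = 0
  ax₃ : ∀ x y z,
    φ (x, y) + φ (y ▵ x, x ▿ y) + φ (y, z) + φ (z ▵ y, y ▿ z)
    + φ (x ▿ y, z ▵ y) + φ ((z ▵ y) ▵ (x ▿ y), (x ▿ y) ▿ (z ▵ y))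
    = φ (x, z) + φ (z ▵ x, x ▿ z)
    + φ (y ▵ x, z ▵ x) + φ ((z ▵ x) ▵ (y ▵ x), (y ▵ x) ▿ (z ▵ x))
    + φ (x ▿ z, y ▿ z) + φ ((y ▿ z) ▵ (x ▿ z), (x ▿ z) ▿ (y ▿ z))

/-- `φ` is a biquandle fare of order 2 of the given type. -/
def IsFare : FareType → (X × X → A) → Prop
  | .complete, φ => IsCompleteFare φ
  | .through, φ => IsThroughFare φ
  | .crooked, φ => IsCrookedFare φ

end Fares

namespace LinkDiagram

open scoped Classical in
/-- The total fare of a colored diagram: the sum of `±φ (x₁, x₂)` over the routes of the given type,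
where `x₁`, `x₂` are the colors of the two semiarcs and the sign is that of the crossing. -/
noncomputable def totalFare {X A : Type*} [AddCommGroup A] (k : FareType) (φ : X × X → A)
    (D : LinkDiagram) (f : D.Semiarc → X) : A :=
  ∑ r : D.Route with k.Admits r, (D.sign r.1 : ℤ) • φ (f r.first, f r.second)

open scoped Classical in
/-- The biquandle fare multiset of a diagram: the total fares of all its colorings. -/
noncomputable def fareMultiset {X A : Type*} [Biquandle X] [Fintype X] [AddCommGroup A]
    (k : FareType) (φ : X × X → A) (D : LinkDiagram) : Multiset A :=
  (Finset.univ.filter (fun f : D.Semiarc → X => D.IsColoring f)).val.map (D.totalFare k φ)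

end LinkDiagram

/-! A coloring puts a single pair `(x, y)` at each crossing: the ends of the lower strand have the
colors `x` and `x ▿ y`, those of the upper strand `y` and `y ▵ x`, and sign and direction only
decide which end has which. The routes at a positive crossing contribute `w (x, y)`, those at a
negative one minus the conjugate weight. By axiom (ii) the two weights agree, so the total fare is
the sum of sign times `w` over all crossings (`HasColorsAt.crossingFare_eq`), and the three types of
fares need no further distinction.

The moves now act on a state sum. A kink forces a diagonal pair, of weight zero by (i). The two
crossings of a type II move carry the same pair with opposite signs and cancel. At a type III move,
all six pairs before and after are expressed by the same three colors `x`, `y`, `z`, and the two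
sums agree by (iii) with terms moved across the equation (`exists_swapped_triangle_colors`).

Colors outside the moved part determine those inside because one end of the lower strand and one end
of the upper strand always determine the pair (`colors_bijective`). To treat all orientations at
once, signs and directions are units `±1`: end `d` of a crossing of sign `s` has the color with
index `-(d * s)` on the lower strand and `d * s` on the upper strand. Multisets are compared by
fare-preserving injections between colorings (`fareMultiset_le`). -/

namespace Biquandle

/-! ### Colors at one crossing and at the crossings of a triangle. -/

variable {X : Type*} [Biquandle X]

/-- The two possible colors of the lower strand at a crossing colored by the pair `p`. -/
def lowerColor (s : ℤˣ) (p : X × X) : X := if s = 1 then p.1 else p.1 ▿ p.2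

/-- The two possible colors of the upper strand at a crossing colored by the pair `p`. -/
def upperColor (s : ℤˣ) (p : X × X) : X := if s = 1 then p.2 else p.2 ▵ p.1

@[simp] theorem lowerColor_one (p : X × X) : lowerColor 1 p = p.1 := rfl

@[simp] theorem upperColor_one (p : X × X) : upperColor 1 p = p.2 := rfl

@[simp] theorem lowerColor_neg_one (p : X × X) : lowerColor (-1) p = p.1 ▿ p.2 :=
  if_neg (by decide)

@[simp] theorem upperColor_neg_one (p : X × X) : upperColor (-1) p = p.2 ▵ p.1 :=
  if_neg (by decide)

theorem over_right_cancel {x x' y : X} (h : x ▵ y = x' ▵ y) : x = x' :=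
  (over_bijective y).1 h

theorem under_right_cancel {x x' y : X} (h : x ▿ y = x' ▿ y) : x = x' :=
  (under_bijective y).1 h

theorem switch_cancel {x y x' y' : X} (h₁ : y ▵ x = y' ▵ x') (h₂ : x ▿ y = x' ▿ y') :
    x = x' ∧ y = y' :=
  Prod.ext_iff.1 (switch_bijective.1 (a₁ := (x, y)) (a₂ := (x', y')) (Prod.ext h₁ h₂))

/-- The color of either end of the lower strand and the color of either end of the upper strand
determine the colors at a crossing. -/
theorem colors_bijective (s t : ℤˣ) :
    Function.Bijective (fun p : X × X => (lowerColor s p, upperColor t p)) := by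
  rcases Int.units_eq_one_or s with rfl | rfl <;> rcases Int.units_eq_one_or t with rfl | rfl
  · exact Function.bijective_id
  · constructor
    · rintro ⟨x, y⟩ ⟨x', y'⟩ h
      simp only [lowerColor_one, upperColor_neg_one, Prod.mk.injEq] at h
      obtain ⟨rfl, h⟩ := h
      rw [over_right_cancel h]
    · rintro ⟨u, v⟩
      obtain ⟨y, hy⟩ := (over_bijective u).2 v
      exact ⟨(u, y), by simpa using hy⟩
  · constructor
    · rintro ⟨x, y⟩ ⟨x', y'⟩ h
      simp only [lowerColor_neg_one, upperColor_one, Prod.mk.injEq] at h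
      obtain ⟨h, rfl⟩ := h
      rw [under_right_cancel h]
    · rintro ⟨u, v⟩
      obtain ⟨x, hx⟩ := (under_bijective v).2 u
      exact ⟨(x, v), by simpa using hx⟩
  · constructor
    · rintro ⟨x, y⟩ ⟨x', y'⟩ h
      simp only [lowerColor_neg_one, upperColor_neg_one, Prod.mk.injEq] at h
      obtain ⟨rfl, rfl⟩ := switch_cancel h.2 h.1
      rfl
    · rintro ⟨u, v⟩
      obtain ⟨p, hp⟩ := switch_bijective.2 (v, u)
      have := Prod.ext_iff.1 hp
      exact ⟨p, Prod.ext (by simpa using this.2) (by simpa using this.1)⟩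

theorem colors_ext {s t : ℤˣ} {p q : X × X} (h₁ : lowerColor s p = lowerColor s q)
    (h₂ : upperColor t p = upperColor t q) : p = q :=
  (colors_bijective s t).1 (Prod.ext h₁ h₂)

theorem exists_colors (s t : ℤˣ) (u v : X) :
    ∃ p : X × X, lowerColor s p = u ∧ upperColor t p = v := by
  obtain ⟨p, hp⟩ := (colors_bijective s t).2 (u, v)
  exact ⟨p, Prod.ext_iff.1 hp⟩

theorem lowerColor_diag (s : ℤˣ) (x : X) : lowerColor s (x, x) = upperColor s (x, x) := by
  rcases Int.units_eq_one_or s with rfl | rfl <;> simp [under_self]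

theorem diag_injective : Function.Injective (fun x : X => x ▿ x) := fun x y h =>
  (switch_cancel (by simpa only [under_self] using h) h).1

/-- The axioms make `x ↦ x ▿ x` injective, as the switch is injective on the diagonal. Surjectivity
comes from the finiteness of `X`. -/
theorem exists_lowerColor_diag [Finite X] (s : ℤˣ) (u : X) : ∃ x : X, lowerColor s (x, x) = u := by
  rcases Int.units_eq_one_or s with rfl | rfl
  · exact ⟨u, rfl⟩
  · simpa using Finite.surjective_of_injective diag_injective u

/-- This governs kinks: the loop is an end of both strands, which forces their colors to agree
there. Some diagonal pair has this color at both ends, and the two ends determine the pair. -/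
theorem exists_eq_diag [Finite X] {s : ℤˣ} {p : X × X} (h : lowerColor s p = upperColor s p) :
    ∃ x, p = (x, x) := by
  obtain ⟨x, hx⟩ := exists_lowerColor_diag s (lowerColor s p)
  exact ⟨x, (colors_ext (s := s) (t := s) hx (by rw [← lowerColor_diag, hx, h])).symm⟩

/-- The colors of the three crossings of a triangle, in terms of the three colors `x`, `y`, `z` that
the bottom, middle and top strand have far from each other. -/
theorem exists_triangle_colors {α β γ : ℤˣ} {p q r : X × X}
    (h₁ : upperColor β p = upperColor γ r) (h₂ : lowerColor α p = upperColor γ q)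
    (h₃ : lowerColor β q = lowerColor α r) :
    ∃ x y z : X, p = (if γ = 1 then (y, z) else (y ▵ x, z ▵ x)) ∧
      q = (if α = 1 then (x, y) else (x ▿ z, y ▿ z)) ∧
      r = (if β = 1 then (x, z) else (x ▿ y, z ▵ y)) := by
  have hne : (-1 : ℤˣ) ≠ 1 := by decide
  obtain ⟨p₁, p₂⟩ := p
  obtain ⟨q₁, q₂⟩ := q
  obtain ⟨r₁, r₂⟩ := r
  -- If at most one sign is `-1`, then `x`, `y`, `z` can be read off directly. With two, one of them
  -- is the solution of an equation, and the remaining identity follows from one exchange law by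
  -- cancellation.
  rcases Int.units_eq_one_or α with rfl | rfl <;> rcases Int.units_eq_one_or β with rfl | rfl <;>
    rcases Int.units_eq_one_or γ with rfl | rfl <;>
    simp only [lowerColor_one, lowerColor_neg_one, upperColor_one, upperColor_neg_one] at h₁ h₂ h₃ <;>
    simp only [if_true, if_neg hne, Prod.mk.injEq]
  · exact ⟨q₁, p₁, p₂, ⟨rfl, rfl⟩, ⟨rfl, h₂.symm⟩, h₃.symm, h₁.symm⟩
  · exact ⟨q₁, q₂, r₂, ⟨h₂, by rw [h₁, h₃]⟩, ⟨rfl, rfl⟩, h₃.symm, rfl⟩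
  · exact ⟨q₁, q₂, p₂, ⟨h₂, rfl⟩, ⟨rfl, rfl⟩, h₃.symm, by rw [← h₁, h₂]⟩
  · obtain ⟨z, rfl⟩ := (over_bijective q₁).2 p₂
    subst h₂ h₃
    refine ⟨q₁, q₂, z, ⟨rfl, rfl⟩, ⟨rfl, rfl⟩, rfl, ?_⟩
    exact over_right_cancel (h₁.symm.trans (exchange₃ z q₁ q₂))
  · exact ⟨r₁, p₁, p₂, ⟨rfl, rfl⟩, ⟨by rw [h₃, h₁], h₂.symm⟩, rfl, h₁.symm⟩
  · obtain ⟨y, rfl⟩ := (over_bijective r₁).2 p₁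
    subst h₁ h₃
    refine ⟨r₁, y, r₂, ⟨rfl, rfl⟩, ⟨rfl, ?_⟩, rfl, rfl⟩
    exact over_right_cancel (h₂.symm.trans (exchange₂ y r₂ r₁).symm)
  · obtain ⟨x, rfl⟩ := (under_bijective p₁).2 r₁
    subst h₁ h₂
    refine ⟨x, p₁, p₂, ⟨rfl, rfl⟩, ⟨?_, rfl⟩, rfl, rfl⟩
    exact under_right_cancel (h₃.trans (exchange₁ x p₂ p₁).symm)
  -- With all three signs `-1`, no pair shows `x` or `y` itself; the switch recovers both from `y ▵
  -- x` and `x ▿ y`.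
  · obtain ⟨⟨x, y⟩, h⟩ := switch_bijective.2 (p₁, r₁)
    obtain ⟨rfl, rfl⟩ := Prod.ext_iff.1 h
    obtain ⟨z, rfl⟩ := (over_bijective x).2 p₂
    have hr : r₂ = z ▵ y := over_right_cancel (h₁.symm.trans (exchange₃ z x y))
    subst hr
    have hq := switch_cancel (h₂.symm.trans (exchange₂ y z x).symm)
      (h₃.trans (exchange₁ x z y).symm)
    exact ⟨x, y, z, ⟨rfl, rfl⟩, hq, rfl, rfl⟩

/-- The colors at the crossings of a triangle determine colors at the crossings of the triangle
after a third Reidemeister move, with the same colors on the outer ends of the strands. -/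
theorem exists_swapped_triangle_colors {A : Type*} [AddCommGroup A] {w : X × X → A}
    (hw : ∀ x y z, w (x, y) + w (y, z) + w (x ▿ y, z ▵ y)
      = w (x, z) + w (y ▵ x, z ▵ x) + w (x ▿ z, y ▿ z))
    {α β γ : ℤˣ} {p q r : X × X}
    (h₁ : upperColor β p = upperColor γ r) (h₂ : lowerColor α p = upperColor γ q)
    (h₃ : lowerColor β q = lowerColor α r) :
    ∃ p' q' r' : X × X,
      (upperColor (-β) p' = upperColor (-γ) r' ∧ lowerColor (-α) p' = upperColor (-γ) q' ∧
        lowerColor (-β) q' = lowerColor (-α) r') ∧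
      (upperColor γ r' = upperColor (-β) p ∧ upperColor β p' = upperColor (-γ) r) ∧
      (upperColor γ q' = lowerColor (-α) p ∧ lowerColor α p' = upperColor (-γ) q) ∧
      (lowerColor α r' = lowerColor (-β) q ∧ lowerColor β q' = lowerColor (-α) r) ∧
      ((α * β : ℤˣ) : ℤ) • w p' + ((β * γ : ℤˣ) : ℤ) • w q' - ((α * γ : ℤˣ) : ℤ) • w r'
        = ((α * β : ℤˣ) : ℤ) • w p + ((β * γ : ℤˣ) : ℤ) • w q - ((α * γ : ℤˣ) : ℤ) • w r := by
  have hne : (-1 : ℤˣ) ≠ 1 := by decide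
  obtain ⟨x, y, z, rfl, rfl, rfl⟩ := exists_triangle_colors h₁ h₂ h₃
  -- The far colors `x`, `y`, `z` stay the same, but each crossing now lies on the other side of the
  -- third strand, so its index is negated.
  refine ⟨if -γ = 1 then (y, z) else (y ▵ x, z ▵ x), if -α = 1 then (x, y) else (x ▿ z, y ▿ z),
    if -β = 1 then (x, z) else (x ▿ y, z ▵ y), ?_⟩
  have e₁ := exchange₁ x z y
  have e₂ := exchange₂ y z x
  have e₃ := exchange₃ z x y
  have e := hw x y z
  clear h₁ h₂ h₃ hw
  rcases Int.units_eq_one_or α with rfl | rfl <;> rcases Int.units_eq_one_or β with rfl | rfl <;>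
    rcases Int.units_eq_one_or γ with rfl | rfl <;>
    simp only [lowerColor_one, lowerColor_neg_one, upperColor_one, upperColor_neg_one, neg_neg,
      if_true, if_neg hne, e₁, e₂, e₃, mul_one, Units.val_one, Units.val_neg, one_smul,
      neg_smul, and_self, true_and, mul_neg]
  -- The identity between the weights is `hw x y z`, with terms on the sides that the signs
  -- prescribe.
  all_goals grind

end Biquandle

/-! ### The fare axioms as conditions on one weight. -/

section Weight

variable {X A : Type*} [Biquandle X] [AddCommGroup A]

/-- The contribution of a positive crossing with the colors `p` to a fare of order 2. -/
def FareType.weight (φ : X × X → A) : FareType → X × X → A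
  | complete, (x, y) => φ (x, y) + φ (x, x ▿ y) + φ (y ▵ x, y) + φ (y ▵ x, x ▿ y)
  | through, (x, y) => φ (x, x ▿ y) + φ (y ▵ x, y)
  | crooked, (x, y) => φ (x, y) + φ (y ▵ x, x ▿ y)

/-- The contribution of a negative crossing with the colors `p` to a fare of order 2, up to sign. -/
def FareType.negWeight (φ : X × X → A) : FareType → X × X → A
  | complete, (x, y) => φ (y, x) + φ (x ▿ y, x) + φ (y, y ▵ x) + φ (x ▿ y, y ▵ x)
  | through, (x, y) => φ (x ▿ y, x) + φ (y, y ▵ x)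
  | crooked, (x, y) => φ (y, x) + φ (x ▿ y, y ▵ x)

variable {φ : X × X → A} {k : FareType}

theorem IsFare.weight_diag (hφ : IsFare k φ) (x : X) : k.weight φ (x, x) = 0 := by
  cases k
  · simpa only [FareType.weight, ← Biquandle.under_self] using IsCompleteFare.ax₁ hφ x
  · simpa only [FareType.weight, ← Biquandle.under_self] using IsThroughFare.ax₁ hφ x
  · simpa only [FareType.weight, ← Biquandle.under_self] using IsCrookedFare.ax₁ hφ x

theorem IsFare.negWeight_eq (hφ : IsFare k φ) (p : X × X) :
    k.negWeight φ p = k.weight φ p := by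
  obtain ⟨x, y⟩ := p
  rw [← sub_eq_zero, ← neg_eq_zero]
  cases k
  · rw [← IsCompleteFare.ax₂ hφ x y]; simp only [FareType.weight, FareType.negWeight]; abel
  · rw [← IsThroughFare.ax₂ hφ x y]; simp only [FareType.weight, FareType.negWeight]; abel
  · rw [← IsCrookedFare.ax₂ hφ x y]; simp only [FareType.weight, FareType.negWeight]; abel

theorem IsFare.weight_triangle (hφ : IsFare k φ) (x y z : X) :
    k.weight φ (x, y) + k.weight φ (y, z) + k.weight φ (x ▿ y, z ▵ y)
      = k.weight φ (x, z) + k.weight φ (y ▵ x, z ▵ x) + k.weight φ (x ▿ z, y ▿ z) := by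
  cases k
  · simpa only [FareType.weight, ← add_assoc] using IsCompleteFare.ax₃ hφ x y z
  · simpa only [FareType.weight, ← add_assoc] using IsThroughFare.ax₃ hφ x y z
  · simpa only [FareType.weight, ← add_assoc] using IsCrookedFare.ax₃ hφ x y z

end Weight

namespace LinkDiagram

open Biquandle

/-! ### Colors and fares at a crossing -/

/-- The semiarc that leaves along a strand of a crossing if `d = 1`, or arrives there if `d = -1`. -/
def arc (D : LinkDiagram) (d : ℤˣ) (P : D.Crossing × Strand) : D.Semiarc :=
  if d = 1 then D.out P else D.inc P

variable {D D' : LinkDiagram}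

@[simp] theorem arc_one (P : D.Crossing × Strand) : D.arc 1 P = D.out P := rfl

@[simp] theorem arc_neg_one (P : D.Crossing × Strand) : D.arc (-1) P = D.inc P :=
  if_neg (by decide)

theorem arc_injective (d : ℤˣ) : Function.Injective (D.arc d) := by
  rcases Int.units_eq_one_or d with rfl | rfl
  · exact D.out_injective
  · intro P Q h
    exact D.inc_injective (by simpa using h)

/-- A semiarc that joins two passages ends nowhere else. -/
theorem arc_eq_arc {d a : ℤˣ} {P Q R : D.Crossing × Strand} (h : D.arc a P = D.arc (-a) Q)
    (hR : D.arc d R = D.arc a P) : (d = a ∧ R = P) ∨ (d = -a ∧ R = Q) := by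
  by_cases hd : d = a
  · subst hd
    exact .inl ⟨rfl, arc_injective d hR⟩
  · have hd : d = -a := by
      rcases Int.units_eq_one_or d with rfl | rfl <;> rcases Int.units_eq_one_or a with rfl | rfl <;>
        simp_all
    subst hd
    exact .inr ⟨rfl, arc_injective (-a) (hR.trans h)⟩

theorem forall_arc {P : D'.Semiarc → D.Semiarc → Prop} {c' : D'.Crossing} {c : D.Crossing}
    (h₁ : ∀ s, P (D'.inc (c', s)) (D.inc (c, s))) (h₂ : ∀ s, P (D'.out (c', s)) (D.out (c, s)))
    (d : ℤˣ) (s : Strand) : P (D'.arc d (c', s)) (D.arc d (c, s)) := by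
  rcases Int.units_eq_one_or d with rfl | rfl
  · exact h₂ s
  · simpa using h₁ s

section Fare

variable {X A : Type*} [AddCommGroup A]

open scoped Classical in
/-- The contribution of a crossing to the total fare. -/
noncomputable def crossingFare (k : FareType) (φ : X × X → A) (D : LinkDiagram)
    (f : D.Semiarc → X) (c : D.Crossing) : A :=
  ∑ s : Strand, ∑ t : Strand,
    if k.Admits (D := D) (c, s, t) then
      (D.sign c : ℤ) • φ (f (D.inc (c, s)), f (D.out (c, t))) else 0

theorem totalFare_eq_sum (k : FareType) (φ : X × X → A) (f : D.Semiarc → X) :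
    D.totalFare k φ f = ∑ c, D.crossingFare k φ f c := by
  classical
  simp only [totalFare, crossingFare, Finset.sum_filter, Fintype.sum_prod_type, Route.first,
    Route.second]

theorem crossingFare_congr {k : FareType} {φ : X × X → A} {f : D.Semiarc → X}
    {f' : D'.Semiarc → X} {c : D.Crossing} {c' : D'.Crossing} (hs : D'.sign c' = D.sign c)
    (hf : ∀ d s, f' (D'.arc d (c', s)) = f (D.arc d (c, s))) :
    D'.crossingFare k φ f' c' = D.crossingFare k φ f c := by
  have h₁ := fun s => by simpa using hf (-1) s
  have h₂ := fun s => by simpa using hf 1 s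
  simp only [crossingFare, h₁, h₂, hs]
  cases k <;> rfl

end Fare

section Color

variable {X A : Type*} [Biquandle X] [AddCommGroup A]

/-- The semiarcs at the crossing `c` are colored according to the pair `p`. -/
def HasColorsAt (D : LinkDiagram) (f : D.Semiarc → X) (c : D.Crossing) (p : X × X) : Prop :=
  ∀ d, f (D.arc d (c, .lower)) = lowerColor (-(d * D.sign c)) p ∧
    f (D.arc d (c, .upper)) = upperColor (d * D.sign c) p

/-- The free directions `a`, `b` allow each strand to be checked in the direction natural for a
move, without splitting into orientations. -/
theorem hasColorsAt_of {f : D.Semiarc → X} {c : D.Crossing} {p : X × X} (a b : ℤˣ)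
    (h₁ : f (D.arc b (c, .lower)) = lowerColor (-(b * D.sign c)) p)
    (h₂ : f (D.arc (-b) (c, .lower)) = lowerColor (b * D.sign c) p)
    (h₃ : f (D.arc a (c, .upper)) = upperColor (a * D.sign c) p)
    (h₄ : f (D.arc (-a) (c, .upper)) = upperColor (-(a * D.sign c)) p) :
    D.HasColorsAt f c p := by
  intro d
  rcases Int.units_eq_one_or d with rfl | rfl <;> rcases Int.units_eq_one_or a with rfl | rfl <;>
    rcases Int.units_eq_one_or b with rfl | rfl <;> simp_all

theorem isColoring_iff {f : D.Semiarc → X} :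
    D.IsColoring f ↔ ∀ c, ∃ p, D.HasColorsAt f c p := by
  have hne : (-1 : ℤˣ) ≠ 1 := by decide
  have hne' : (1 : ℤˣ) ≠ -1 := by decide
  refine forall_congr' fun c => ⟨fun h => ?_, ?_⟩
  · rcases Int.units_eq_one_or (D.sign c) with hs | hs
    · refine ⟨(f (D.inc (c, .lower)), f (D.out (c, .upper))), hasColorsAt_of 1 1 ?_ ?_ ?_ ?_⟩ <;>
        simp [hs, h.1 hs]
    · refine ⟨(f (D.out (c, .lower)), f (D.inc (c, .upper))), hasColorsAt_of 1 1 ?_ ?_ ?_ ?_⟩ <;>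
        simp [hs, h.2 hs]
  · rintro ⟨p, hp⟩
    have h₁ := hp 1
    have h₂ := hp (-1)
    rcases Int.units_eq_one_or (D.sign c) with hs | hs <;> simp_all

theorem HasColorsAt.congr {f : D.Semiarc → X} {f' : D'.Semiarc → X} {c : D.Crossing}
    {c' : D'.Crossing} {p : X × X} (h : D.HasColorsAt f c p) (hs : D'.sign c' = D.sign c)
    (hf : ∀ d s, f' (D'.arc d (c', s)) = f (D.arc d (c, s))) : D'.HasColorsAt f' c' p := by
  intro d
  rw [hf, hf, hs]
  exact h d

/-- The admitted routes add up to `weight` at a positive and to `negWeight` at a negative crossing;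
axiom (ii) identifies the two. -/
theorem HasColorsAt.crossingFare_eq {k : FareType} {φ : X × X → A} (hφ : IsFare k φ)
    {f : D.Semiarc → X} {c : D.Crossing} {p : X × X} (h : D.HasColorsAt f c p) :
    D.crossingFare k φ f c = (D.sign c : ℤ) • k.weight φ p := by
  have h₁ := h 1
  have h₂ := h (-1)
  have hS : (Finset.univ : Finset Strand) = {.upper, .lower} := rfl
  have hw := hφ.negWeight_eq p
  rcases Int.units_eq_one_or (D.sign c) with hs | hs <;>
    simp only [hs, mul_one, arc_one, arc_neg_one, neg_neg, lowerColor_one, lowerColor_neg_one,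
      upperColor_one, upperColor_neg_one, mul_neg] at h₁ h₂
  · cases k <;>
      simp [crossingFare, hS, h₁, h₂, hs, FareType.weight, FareType.Admits] <;> abel
  · rw [← hw]
    cases k <;>
      simp [crossingFare, hS, h₁, h₂, hs, FareType.negWeight, FareType.Admits] <;> abel

/-- Any choice of partners under `r` is injective on colorings by `hr`, so it embeds one multiset of
fares in the other. Using this in both directions avoids constructing a bijection. -/
theorem fareMultiset_le [Fintype X] {k : FareType} {φ : X × X → A}
    (r : (D.Semiarc → X) → (D'.Semiarc → X) → Prop)
    (h : ∀ f, D.IsColoring f →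
      ∃ f', r f f' ∧ D'.IsColoring f' ∧ D'.totalFare k φ f' = D.totalFare k φ f)
    (hr : ∀ f₁ f₂ f', D.IsColoring f₁ → D.IsColoring f₂ → r f₁ f' → r f₂ f' → f₁ = f₂) :
    fareMultiset k φ D ≤ fareMultiset k φ D' := by
  classical
  -- `choose!` needs a default value in `D'.Semiarc → X`, which may be empty if `D` has no coloring.
  by_cases hD : ∃ f : D.Semiarc → X, D.IsColoring f
  swap
  · have : fareMultiset k φ D = 0 := by
      simpa [fareMultiset, Finset.filter_eq_empty_iff] using hD
    exact this ▸ Multiset.zero_le _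
  have : Nonempty (D'.Semiarc → X) := hD.elim fun f hf => ⟨(h f hf).choose⟩
  choose! g hg using h
  unfold fareMultiset
  set s := Finset.univ.filter (fun f : D.Semiarc → X => D.IsColoring f) with hs
  set t := Finset.univ.filter (fun f : D'.Semiarc → X => D'.IsColoring f) with ht
  have hmap : s.val.map (D.totalFare k φ) = (s.image g).val.map (D'.totalFare k φ) := by
    rw [Finset.image_val_of_injOn, Multiset.map_map]
    · refine Multiset.map_congr rfl fun f hf => ?_
      have hf : D.IsColoring f := by simpa [hs] using hf
      exact (hg f hf).2.2.symm
    · intro f₁ h₁ f₂ h₂ e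
      have h₁ : D.IsColoring f₁ := by simpa [hs] using h₁
      have h₂ : D.IsColoring f₂ := by simpa [hs] using h₂
      exact hr f₁ f₂ _ h₁ h₂ (hg f₁ h₁).1 (by rw [e]; exact (hg f₂ h₂).1)
  rw [hmap]
  refine Multiset.map_le_map (Finset.val_le_iff.2 fun f' hf' => ?_)
  obtain ⟨f, hf, rfl⟩ := Finset.mem_image.1 hf'
  have hf : D.IsColoring f := by simpa [hs] using hf
  simpa [ht] using (hg f hf).2.1

/-! ### Isomorphisms -/

theorem Iso.symm (h : Iso D D') : Iso D' D := by
  obtain ⟨κ, τ, h₁, h₂, h₃⟩ := h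
  refine ⟨κ.symm, τ.symm, fun c => ?_, fun c s => ?_, fun c s => ?_⟩
  · rw [← h₁, κ.apply_symm_apply]
  · rw [Equiv.eq_symm_apply, ← h₂, κ.apply_symm_apply]
  · rw [Equiv.eq_symm_apply, ← h₃, κ.apply_symm_apply]

theorem Iso.fareMultiset_le [Fintype X] {k : FareType} {φ : X × X → A} (h : Iso D D') :
    fareMultiset k φ D ≤ fareMultiset k φ D' := by
  obtain ⟨κ, τ, h₁, h₂, h₃⟩ := h
  have key : ∀ (f : D.Semiarc → X) c d s,
      f (τ.symm (D'.arc d (κ c, s))) = f (D.arc d (c, s)) := fun f c d s =>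
    forall_arc (P := fun e' e => f (τ.symm e') = f e) (fun s => by rw [h₂, τ.symm_apply_apply])
      (fun s => by rw [h₃, τ.symm_apply_apply]) d s
  refine LinkDiagram.fareMultiset_le (fun f f' => f' = f ∘ τ.symm)
    (fun f hf => ⟨_, rfl, ?_, ?_⟩) ?_
  · rw [isColoring_iff] at hf ⊢
    intro c'
    obtain ⟨c, rfl⟩ := κ.surjective c'
    obtain ⟨p, hp⟩ := hf c
    exact ⟨p, hp.congr (h₁ c) (key f c)⟩
  · rw [totalFare_eq_sum, totalFare_eq_sum, ← Equiv.sum_comp κ]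
    exact Finset.sum_congr rfl fun c _ => crossingFare_congr (h₁ c) (key f c)
  · rintro f₁ f₂ f' - - e₁ e₂
    exact τ.symm.surjective.injective_comp_right (e₁.symm.trans e₂)

/-! ### Erasing crossings -/

/-- Functions on the semiarcs of `D` are, via `π`, the functions on those of `D'` that do not change
across `S`. It remains to match these with the functions colored correctly at `S`, keeping all
values off the inner semiarcs `I`. Crossings outside `S` have no end in `I`, so they notice no
change, and those in `S` contribute nothing in total. -/
theorem IsErasure.fareMultiset_eq [Fintype X] {k : FareType} {φ : X × X → A}
    {S : Finset D'.Crossing} (hE : IsErasure D' S D) (I : Set D'.Semiarc)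
    (hI : ∀ c ∉ S, ∀ d s, D'.arc d (c, s) ∉ I)
    (hext : ∀ h : D'.Semiarc → X, (∀ c ∈ S, ∀ s, h (D'.inc (c, s)) = h (D'.out (c, s))) →
      ∃ f, Set.EqOn f h Iᶜ ∧ ∀ c ∈ S, ∃ p, D'.HasColorsAt f c p)
    (hres : ∀ f : D'.Semiarc → X, (∀ c ∈ S, ∃ p, D'.HasColorsAt f c p) →
      ∃ h, Set.EqOn f h Iᶜ ∧ ∀ c ∈ S, ∀ s, h (D'.inc (c, s)) = h (D'.out (c, s)))
    (hext_unique : ∀ f₁ f₂ : D'.Semiarc → X, (∀ c ∈ S, ∃ p, D'.HasColorsAt f₁ c p) →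
      (∀ c ∈ S, ∃ p, D'.HasColorsAt f₂ c p) → Set.EqOn f₁ f₂ Iᶜ → f₁ = f₂)
    (hres_unique : ∀ h₁ h₂ : D'.Semiarc → X,
      (∀ c ∈ S, ∀ s, h₁ (D'.inc (c, s)) = h₁ (D'.out (c, s))) →
      (∀ c ∈ S, ∀ s, h₂ (D'.inc (c, s)) = h₂ (D'.out (c, s))) → Set.EqOn h₁ h₂ Iᶜ → h₁ = h₂)
    (hfare : ∀ f : D'.Semiarc → X, (∀ c ∈ S, ∃ p, D'.HasColorsAt f c p) →
      ∑ c ∈ S, D'.crossingFare k φ f c = 0) :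
    fareMultiset k φ D = fareMultiset k φ D' := by
  classical
  obtain ⟨κ, π, hκ, hκS, hπ, hπ', hsign, hinc, hout⟩ := hE
  have hκn : ∀ x, κ x ∉ S := fun x => by
    have : κ x ∈ (S : Set D'.Crossing)ᶜ := hκS ▸ Set.mem_range_self x
    simpa using this
  have hcases : ∀ c ∉ S, ∃ x, κ x = c := fun c hc => by
    have : c ∈ Set.range κ := hκS ▸ (by simpa using hc)
    exact this
  have hcomp : ∀ (g : D.Semiarc → X), ∀ c ∈ S, ∀ s,
      (g ∘ π) (D'.inc (c, s)) = (g ∘ π) (D'.out (c, s)) := fun g c hc s =>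
    congrArg g ((hπ' _ _).2 (.rel _ _ ⟨c, by simpa using hc, s, rfl, rfl⟩))
  have hfactor : ∀ h : D'.Semiarc → X,
      (∀ c ∈ S, ∀ s, h (D'.inc (c, s)) = h (D'.out (c, s))) → ∃ g : D.Semiarc → X, g ∘ π = h := by
    intro h hh
    have hconst : ∀ e e', π e = π e' → h e = h e' := fun e e' he => by
      replace he := (hπ' _ _).1 he
      clear hπ'
      induction he with
      | rel a b hab =>
        obtain ⟨c, hc, s, rfl, rfl⟩ := hab
        exact hh c (by simpa using hc) s
      | refl => rfl
      | symm _ _ _ ih => exact ih.symm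
      | trans _ _ _ _ _ ih₁ ih₂ => exact ih₁.trans ih₂
    exact ⟨fun e => h (Function.surjInv hπ e), funext fun e =>
      hconst _ _ (Function.surjInv_eq hπ (π e))⟩
  have key : ∀ (f : D'.Semiarc → X) (g : D.Semiarc → X), Set.EqOn f (g ∘ π) Iᶜ → ∀ x d s,
      f (D'.arc d (κ x, s)) = g (D.arc d (x, s)) := fun f g hfg x d s => by
    rw [hfg (hI _ (hκn x) d s)]
    exact forall_arc (P := fun e' e => (g ∘ π) e' = g e) (fun s => by rw [hinc]; rfl)
      (fun s => by rw [hout]; rfl) d s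
  have hcol : ∀ (f : D'.Semiarc → X) (g : D.Semiarc → X), Set.EqOn f (g ∘ π) Iᶜ →
      (∀ c ∈ S, ∃ p, D'.HasColorsAt f c p) → (D'.IsColoring f ↔ D.IsColoring g) ∧
      D'.totalFare k φ f = D.totalFare k φ g := by
    intro f g hfg hS
    refine ⟨?_, ?_⟩
    · rw [isColoring_iff, isColoring_iff]
      refine ⟨fun h x => ?_, fun h c => ?_⟩
      · obtain ⟨p, hp⟩ := h (κ x)
        exact ⟨p, hp.congr (hsign x).symm fun d s => (key f g hfg x d s).symm⟩
      · by_cases hc : c ∈ S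
        · exact hS c hc
        · obtain ⟨x, rfl⟩ := hcases c hc
          obtain ⟨p, hp⟩ := h x
          exact ⟨p, hp.congr (hsign x) (key f g hfg x)⟩
    · rw [totalFare_eq_sum, totalFare_eq_sum, ← Finset.sum_add_sum_compl S, hfare f hS, zero_add]
      refine (Finset.sum_bij (fun x _ => κ x) (fun x _ => by simpa using hκn x)
        (fun x _ y _ h => hκ h) (fun c hc => ?_) fun x _ => ?_).symm
      · obtain ⟨x, hx⟩ := hcases c (by simpa using hc)
        exact ⟨x, Finset.mem_univ _, hx⟩
      · exact (crossingFare_congr (hsign x) (key f g hfg x)).symm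
  refine le_antisymm ?_ ?_
  · refine LinkDiagram.fareMultiset_le (fun g f => Set.EqOn f (g ∘ π) Iᶜ) (fun g hg => ?_) ?_
    · obtain ⟨f, hfg, hS⟩ := hext _ (hcomp g)
      have h := hcol f g hfg hS
      exact ⟨f, hfg, h.1.2 hg, h.2⟩
    · intro g₁ g₂ f _ _ h₁ h₂
      exact hπ.injective_comp_right
        (hres_unique _ _ (hcomp g₁) (hcomp g₂) fun e he => (h₁ he).symm.trans (h₂ he))
  · refine LinkDiagram.fareMultiset_le (fun f g => Set.EqOn f (g ∘ π) Iᶜ) (fun f hf => ?_) ?_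
    · have hS : ∀ c ∈ S, ∃ p, D'.HasColorsAt f c p := fun c _ => isColoring_iff.1 hf c
      obtain ⟨h, hfh, hh⟩ := hres f hS
      obtain ⟨g, rfl⟩ := hfactor h hh
      have h := hcol f g hfh hS
      exact ⟨g, hfh, h.1.1 hf, h.2.symm⟩
    · intro f₁ f₂ g hf₁ hf₂ h₁ h₂
      exact hext_unique _ _ (fun c _ => isColoring_iff.1 hf₁ c) (fun c _ => isColoring_iff.1 hf₂ c)
        fun e he => (h₁ he).trans (h₂ he).symm

end Color

end LinkDiagram

namespace LinkDiagram

open Biquandle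

variable {D D' : LinkDiagram}

theorem inc_eq_out_iff {X : Type*} {h : D.Semiarc → X} {c : D.Crossing} {s : Strand} (d : ℤˣ) :
    h (D.inc (c, s)) = h (D.out (c, s)) ↔ h (D.arc d (c, s)) = h (D.arc (-d) (c, s)) := by
  rcases Int.units_eq_one_or d with rfl | rfl <;> simp [eq_comm]

theorem forall_strand {P : Strand → Prop} : (∀ s, P s) ↔ P .upper ∧ P .lower :=
  ⟨fun h => ⟨h _, h _⟩, fun h s => by cases s; exacts [h.1, h.2]⟩

theorem units_ne_neg (d : ℤˣ) : d ≠ -d := by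
  rcases Int.units_eq_one_or d with rfl | rfl <;> decide

section FareInvariance

variable {X A : Type*} [Biquandle X] [Fintype X] [AddCommGroup A]
  {k : FareType} {φ : X × X → A}

/-! ### The first and the second Reidemeister move -/

theorem MoveI.fareMultiset_eq (hφ : IsFare k φ) (h : MoveI D D') :
    fareMultiset k φ D = fareMultiset k φ D' := by
  classical
  obtain ⟨c, hc, hE⟩ := h
  obtain ⟨d, hd⟩ : ∃ d, D'.arc d (c, .upper) = D'.arc (-d) (c, .lower) := by
    rcases hc with hc | hc
    · exact ⟨1, by simpa using hc⟩
    · exact ⟨-1, by simpa using hc.symm⟩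
  clear hc
  set e := D'.arc d (c, .upper) with he
  have hdiag : ∀ {f : D'.Semiarc → X}, (∃ p, D'.HasColorsAt f c p) →
      ∃ x, D'.HasColorsAt f c (x, x) := by
    rintro f ⟨p, hp⟩
    have h₁ := (hp d).2
    have h₂ := (hp (-d)).1
    rw [← hd, he, h₁, neg_mul, neg_neg] at h₂
    obtain ⟨x, rfl⟩ := exists_eq_diag h₂.symm
    exact ⟨x, hp⟩
  have hU : D'.arc (-d) (c, .upper) ≠ e := fun h => by
    rcases arc_eq_arc hd h with h | h
    · exact units_ne_neg d h.1.symm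
    · simp at h
  have hL : D'.arc d (c, .lower) ≠ e := fun h => by
    rcases arc_eq_arc hd h with h | h
    · simp at h
    · exact units_ne_neg d h.1
  have hconst : ∀ h : D'.Semiarc → X, (∀ s, h (D'.inc (c, s)) = h (D'.out (c, s))) ↔
      h e = h (D'.arc (-d) (c, .upper)) ∧ h e = h (D'.arc d (c, .lower)) := fun h => by
    rw [forall_strand, inc_eq_out_iff d, inc_eq_out_iff d, ← hd, eq_comm (b := h e)]
  refine IsErasure.fareMultiset_eq (S := {c}) (by simpa using hE) {e} ?_ ?_ ?_ ?_ ?_ ?_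
  · intro x hx a s h
    rcases arc_eq_arc hd h with h | h <;> simp_all
  · intro h hh
    simp only [Finset.mem_singleton, forall_eq, hconst] at hh ⊢
    -- Both outer ends of the kink must keep the color `h e`; this fixes `x`, and the loop `e` gets
    -- the other color of the pair `(x, x)`.
    obtain ⟨x, hx⟩ := exists_lowerColor_diag (-(d * D'.sign c)) (h e)
    refine ⟨Function.update h e (upperColor (d * D'.sign c) (x, x)),
      fun a ha => Function.update_of_ne ha _ _, (x, x), hasColorsAt_of d d ?_ ?_ ?_ ?_⟩
    · rw [Function.update_of_ne hL, ← hh.2, hx]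
    · rw [← hd, Function.update_self, lowerColor_diag]
    · rw [Function.update_self]
    · rw [Function.update_of_ne hU, ← hh.1, ← hx, lowerColor_diag]
  · intro f hf
    simp only [Finset.mem_singleton, forall_eq, hconst] at hf ⊢
    obtain ⟨x, hx⟩ := hdiag hf
    refine ⟨Function.update f e (f (D'.arc d (c, .lower))),
      fun a ha => (Function.update_of_ne ha _ _).symm, ?_, ?_⟩
    · rw [Function.update_self, Function.update_of_ne hU, (hx d).1, (hx (-d)).2, neg_mul,
        lowerColor_diag]
    · rw [Function.update_self, Function.update_of_ne hL]
  · intro f₁ f₂ h₁ h₂ h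
    simp only [Finset.mem_singleton, forall_eq] at h₁ h₂
    obtain ⟨x, hx⟩ := hdiag h₁
    obtain ⟨y, hy⟩ := hdiag h₂
    have e₁ := h hL
    have e₂ := h hU
    rw [(hx d).1, (hy d).1] at e₁
    rw [(hx (-d)).2, (hy (-d)).2] at e₂
    have hxy := colors_ext e₁ e₂
    funext a
    by_cases ha : a = e
    · rw [ha, he, (hx d).2, (hy d).2, hxy]
    · exact h ha
  · intro f₁ f₂ h₁ h₂ h
    simp only [Finset.mem_singleton, forall_eq, hconst] at h₁ h₂
    funext a
    by_cases ha : a = e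
    · rw [ha, h₁.1, h₂.1, h hU]
    · exact h ha
  · intro f hf
    simp only [Finset.mem_singleton, forall_eq] at hf
    obtain ⟨x, hx⟩ := hdiag hf
    rw [Finset.sum_singleton, hx.crossingFare_eq hφ, hφ.weight_diag, smul_zero]

theorem MoveII.fareMultiset_eq (hφ : IsFare k φ) (h : MoveII D D') :
    fareMultiset k φ D = fareMultiset k φ D' := by
  classical
  obtain ⟨c, d, hcd, hsign, hu, hl, hE⟩ := h
  replace hu : D'.arc 1 (c, .upper) = D'.arc (-1) (d, .upper) := by simpa using hu
  obtain ⟨b, hb⟩ : ∃ b, D'.arc b (c, .lower) = D'.arc (-b) (d, .lower) := by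
    rcases hl with hl | hl
    · exact ⟨1, by simpa using hl⟩
    · exact ⟨-1, by simpa using hl.symm⟩
  clear hl
  set u := D'.arc 1 (c, .upper) with hu'
  set l := D'.arc b (c, .lower) with hl'
  have hul : u ≠ l := fun h => by
    rcases arc_eq_arc hb h with h | h <;> simp at h
  have hU : ∀ {a x}, D'.arc a (x, .upper) ≠ l := fun h => by
    rcases arc_eq_arc hb h with h | h <;> simp at h
  have hL : ∀ {a x}, D'.arc a (x, .lower) ≠ u := fun h => by
    rcases arc_eq_arc hu h with h | h <;> simp at h
  have hcU : D'.arc (-1) (c, .upper) ≠ u := fun h => by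
    rcases arc_eq_arc hu h with h | h
    · exact units_ne_neg 1 h.1.symm
    · simp [hcd] at h
  have hdU : D'.arc 1 (d, .upper) ≠ u := fun h => by
    rcases arc_eq_arc hu h with h | h
    · simp [hcd.symm] at h
    · exact units_ne_neg 1 h.1
  have hcL : D'.arc (-b) (c, .lower) ≠ l := fun h => by
    rcases arc_eq_arc hb h with h | h
    · exact units_ne_neg b h.1.symm
    · simp [hcd] at h
  have hdL : D'.arc b (d, .lower) ≠ l := fun h => by
    rcases arc_eq_arc hb h with h | h
    · simp [hcd.symm] at h
    · exact units_ne_neg b h.1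
  have hconst : ∀ h : D'.Semiarc → X,
      (∀ x ∈ ({c, d} : Finset D'.Crossing), ∀ s, h (D'.inc (x, s)) = h (D'.out (x, s))) ↔
      (h u = h (D'.arc (-1) (c, .upper)) ∧ h l = h (D'.arc (-b) (c, .lower))) ∧
      (h u = h (D'.arc 1 (d, .upper)) ∧ h l = h (D'.arc b (d, .lower))) := fun h => by
    simp only [Finset.mem_insert, Finset.mem_singleton, forall_eq_or_imp, forall_eq]
    rw [forall_strand, forall_strand, inc_eq_out_iff 1, inc_eq_out_iff b,
      inc_eq_out_iff (c := d) 1, inc_eq_out_iff (c := d) b, ← hu, ← hb, eq_comm (b := h u),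
      eq_comm (b := h l)]
  -- The inner semiarcs `u` and `l` are ends of both crossings. As the signs are opposite, they have
  -- the same color indices at both, which forces equal pairs.
  have hgood : ∀ f : D'.Semiarc → X,
      (∀ x ∈ ({c, d} : Finset D'.Crossing), ∃ p, D'.HasColorsAt f x p) ↔
      ∃ p, D'.HasColorsAt f c p ∧ D'.HasColorsAt f d p := fun f => by
    simp only [Finset.mem_insert, Finset.mem_singleton, forall_eq_or_imp, forall_eq]
    refine ⟨?_, fun ⟨p, hp⟩ => ⟨⟨p, hp.1⟩, p, hp.2⟩⟩
    rintro ⟨⟨p, hp⟩, q, hq⟩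
    have h₁ := (hq (-b)).1
    have h₂ := (hq (-1)).2
    rw [← hb, (hp b).1, hsign, neg_mul_neg] at h₁
    rw [← hu, (hp 1).2, hsign, neg_mul_neg] at h₂
    obtain rfl := colors_ext h₁ h₂
    exact ⟨p, hp, hq⟩
  refine IsErasure.fareMultiset_eq (S := {c, d}) (by simpa using hE) {u, l} ?_ ?_ ?_ ?_ ?_ ?_
  · rintro x hx a s (h | h)
    · rcases arc_eq_arc hu h with h | h <;> simp_all
    · rcases arc_eq_arc hb h with h | h <;> simp_all
  · intro h hh
    rw [hconst] at hh
    simp only [hgood]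
    -- The pair is determined by the outer ends at `c`.
    obtain ⟨p, hp₁, hp₂⟩ := exists_colors (b * D'.sign c) (-D'.sign c) (h l) (h u)
    let f : D'.Semiarc → X := fun a => if a = u then upperColor (D'.sign c) p else
      if a = l then lowerColor (-(b * D'.sign c)) p else h a
    have fu : f u = upperColor (D'.sign c) p := if_pos rfl
    have fl : f l = lowerColor (-(b * D'.sign c)) p := (if_neg hul.symm).trans (if_pos rfl)
    have fo : ∀ {a}, a ≠ u → a ≠ l → f a = h a := fun h₁ h₂ => (if_neg h₁).trans (if_neg h₂)
    refine ⟨f, fun a ha => ?_, p, hasColorsAt_of 1 b ?_ ?_ ?_ ?_, hasColorsAt_of 1 b ?_ ?_ ?_ ?_⟩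
    · simp only [Set.mem_compl_iff, Set.mem_insert_iff, Set.mem_singleton_iff, not_or] at ha
      exact fo ha.1 ha.2
    · exact fl
    · rw [fo hL hcL, ← hh.1.2, hp₁]
    · rw [← hu', fu, one_mul]
    · rw [fo hcU hU, ← hh.1.1, ← hp₂, one_mul]
    · rw [fo hL hdL, ← hh.2.2, ← hp₁, hsign, mul_neg, neg_neg]
    · rw [← hb, fl, hsign, mul_neg]
    · rw [fo hdU hU, ← hh.2.1, ← hp₂, hsign, one_mul]
    · rw [← hu, fu, hsign, one_mul, neg_neg]
  · intro f hf
    obtain ⟨p, hp, hq⟩ := (hgood f).1 hf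
    simp only [hconst]
    let h : D'.Semiarc → X := fun a => if a = u then f (D'.arc (-1) (c, .upper)) else
      if a = l then f (D'.arc (-b) (c, .lower)) else f a
    have fu : h u = f (D'.arc (-1) (c, .upper)) := if_pos rfl
    have fl : h l = f (D'.arc (-b) (c, .lower)) := (if_neg hul.symm).trans (if_pos rfl)
    have fo : ∀ {a}, a ≠ u → a ≠ l → h a = f a := fun h₁ h₂ => (if_neg h₁).trans (if_neg h₂)
    refine ⟨h, fun a ha => ?_, ⟨?_, ?_⟩, ?_, ?_⟩
    · simp only [Set.mem_compl_iff, Set.mem_insert_iff, Set.mem_singleton_iff, not_or] at ha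
      exact (fo ha.1 ha.2).symm
    · rw [fu, fo hcU hU]
    · rw [fl, fo hL hcL]
    · rw [fu, fo hdU hU, (hp (-1)).2, (hq 1).2, hsign, neg_mul, mul_neg]
    · rw [fl, fo hL hdL, (hp (-b)).1, (hq b).1, hsign, neg_mul, mul_neg]
  · intro f₁ f₂ h₁ h₂ h
    obtain ⟨p, hp, -⟩ := (hgood f₁).1 h₁
    obtain ⟨q, hq, -⟩ := (hgood f₂).1 h₂
    have e₁ := h (x := D'.arc (-b) (c, .lower)) (by simp [hL, hcL])
    have e₂ := h (x := D'.arc (-1) (c, .upper)) (by simp [hU, hcU, -arc_neg_one])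
    rw [(hp (-b)).1, (hq (-b)).1] at e₁
    rw [(hp (-1)).2, (hq (-1)).2] at e₂
    obtain rfl := colors_ext e₁ e₂
    funext a
    by_cases ha : a ∈ ({u, l} : Set _)
    · rcases ha with rfl | rfl
      · rw [hu', (hp 1).2, (hq 1).2]
      · rw [hl', (hp b).1, (hq b).1]
    · exact h ha
  · intro f₁ f₂ h₁ h₂ h
    rw [hconst] at h₁ h₂
    funext a
    by_cases ha : a ∈ ({u, l} : Set _)
    · rcases ha with rfl | rfl
      · rw [h₁.1.1, h₂.1.1]
        exact h (by simp [hU, hcU, -arc_neg_one])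
      · rw [h₁.1.2, h₂.1.2]
        exact h (by simp [hL, hcL])
    · exact h ha
  · intro f hf
    obtain ⟨p, hp, hq⟩ := (hgood f).1 hf
    rw [Finset.sum_pair hcd, hp.crossingFare_eq hφ, hq.crossingFare_eq hφ, hsign, Units.val_neg,
      neg_smul, add_neg_cancel]

/-! ### The third Reidemeister move -/

theorem Swapped.symm {κ : D.Crossing ≃ D'.Crossing} {τ : D.Semiarc ≃ D'.Semiarc}
    {a : ℤˣ} {c d : D.Crossing} {s t : Strand} (h : Swapped κ τ (inOrder a (c, s) (d, t))) :
    Swapped κ.symm τ.symm (inOrder (-a) (κ c, s) (κ d, t)) := by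
  rcases Int.units_eq_one_or a with rfl | rfl
  · obtain ⟨h₁, h₂, h₃, h₄, h₅⟩ := h
    have e : inOrder (-1) (κ c, s) (κ d, t) = ((κ d, t), (κ c, s)) := if_neg (by decide)
    rw [e]
    simp only [Swapped, inOrder, if_true] at *
    simp [h₁, h₂, h₃, h₄, h₅]
  · have e : inOrder (-1) (c, s) (d, t) = ((d, t), (c, s)) := if_neg (by decide)
    rw [e] at h
    obtain ⟨h₁, h₂, h₃, h₄, h₅⟩ := h
    rw [neg_neg]
    simp only [Swapped, inOrder, if_true] at *
    simp [h₁, h₂, h₃, h₄, h₅]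

/-- Read in the direction `a`, both orders of the passages give the same equations. -/
theorem Swapped.arcs {κ : D.Crossing ≃ D'.Crossing} {τ : D.Semiarc ≃ D'.Semiarc}
    {a : ℤˣ} {c d : D.Crossing} {s t : Strand} (h : Swapped κ τ (inOrder a (c, s) (d, t))) :
    D.arc a (c, s) = D.arc (-a) (d, t) ∧
    D'.arc (-a) (κ c, s) = τ (D.arc a (c, s)) ∧ D'.arc a (κ c, s) = τ (D.arc a (d, t)) ∧
    D'.arc (-a) (κ d, t) = τ (D.arc (-a) (c, s)) ∧ D'.arc a (κ d, t) = τ (D.arc a (c, s)) := by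
  rcases Int.units_eq_one_or a with rfl | rfl
  · obtain ⟨h₁, h₂, h₃, h₄, h₅⟩ := h
    simp only [inOrder, if_true] at *
    simp [h₁, h₂, h₃, h₄, h₅]
  · have e : inOrder (-1) (c, s) (d, t) = ((d, t), (c, s)) := if_neg (by decide)
    rw [e] at h
    obtain ⟨h₁, h₂, h₃, h₄, h₅⟩ := h
    simp only at *
    simp [h₁, h₂, h₃, h₄, h₅]

/-- The inverse move negates `a`, `b`, `c` and keeps `ε`; the signs of the crossings involve only
products of two of them. -/
theorem MoveIII.symm (h : MoveIII D D') : MoveIII D' D := by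
  obtain ⟨κ, τ, tm, mb, tb, ε, a, b, c, h₁, h₂, h₃, s₁, s₂, s₃, hs, hT, hM, hB, ho⟩ := h
  refine ⟨κ.symm, τ.symm, κ tm, κ mb, κ tb, ε, -a, -b, -c, by simpa, by simpa, by simpa,
    by simp [hs, s₁], by simp [hs, s₂], by simp [hs, s₃], fun x => ?_, hT.symm, hM.symm, hB.symm,
    fun x s hx₁ hx₂ hx₃ => ?_⟩
  · rw [← hs, κ.apply_symm_apply]
  · obtain ⟨y, rfl⟩ := κ.surjective x
    have := ho y s (by simpa using hx₁) (by simpa using hx₂) (by simpa using hx₃)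
    simp [this]

theorem MoveIII.fareMultiset_le (hφ : IsFare k φ) (h : MoveIII D D') :
    fareMultiset k φ D ≤ fareMultiset k φ D' := by
  classical
  obtain ⟨κ, τ, tm, mb, tb, ε, a, b, c, h₁, h₂, h₃, s₁, s₂, s₃, hs, hT, hM, hB, ho⟩ := h
  obtain ⟨eT, T₁, T₂, T₃, T₄⟩ := hT.arcs
  obtain ⟨eM, M₁, M₂, M₃, M₄⟩ := hM.arcs
  obtain ⟨eB, B₁, B₂, B₃, B₄⟩ := hB.arcs
  clear hT hM hB
  have sq : ∀ u v : ℤˣ, u * (u * v) = v := fun u v => by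
    rw [← mul_assoc, Int.units_mul_self, one_mul]
  -- These products are the color indices at the crossings: each strand gets the index of the third
  -- side's partner, so that `-(ε * a)`, `-(ε * b)`, `-(ε * c)` serve as `α`, `β`, `γ` of the
  -- triangle lemma.
  have a₁ : a * D.sign tm = ε * b := by rw [s₁, mul_assoc, mul_left_comm, sq]
  have b₁ : b * D.sign tm = ε * a := by rw [s₁, mul_comm, mul_assoc, Int.units_mul_self, mul_one]
  have b₂ : b * D.sign mb = ε * c := by rw [s₂, mul_assoc, mul_left_comm, sq]
  have c₂ : c * D.sign mb = ε * b := by rw [s₂, mul_comm, mul_assoc, Int.units_mul_self, mul_one]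
  have a₃ : a * D.sign tb = -(ε * c) := by rw [s₃, mul_neg, mul_assoc, mul_left_comm, sq]
  have c₃ : c * D.sign tb = -(ε * a) := by
    rw [s₃, mul_neg, mul_comm, mul_assoc, Int.units_mul_self, mul_one]
  set iT := D.arc a (tb, .upper) with hT
  set iM := D.arc b (tm, .lower) with hM
  set iB := D.arc c (mb, .lower) with hB
  have nT : ∀ {d x s}, D.arc d (x, s) = iT → s = .upper ∧ (d = a ∧ x = tb ∨ d = -a ∧ x = tm) :=
    fun h => by rcases arc_eq_arc eT h with h | h <;> simp_all
  have nM : ∀ {d x s}, D.arc d (x, s) = iM →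
      (d = b ∧ x = tm ∧ s = .lower) ∨ (d = -b ∧ x = mb ∧ s = .upper) :=
    fun h => by rcases arc_eq_arc eM h with h | h <;> simp_all
  have nB : ∀ {d x s}, D.arc d (x, s) = iB → s = .lower ∧ (d = c ∧ x = mb ∨ d = -c ∧ x = tb) :=
    fun h => by rcases arc_eq_arc eB h with h | h <;> simp_all
  have na := (units_ne_neg a).symm
  have nb := (units_ne_neg b).symm
  have nc := (units_ne_neg c).symm
  have hTM : iM ≠ iT := fun h => by simpa using nT h
  have hTB : iB ≠ iT := fun h => by simpa using nT h
  have hMB : iB ≠ iM := fun h => by simpa [h₁.symm] using nM h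
  have hout : ∀ d x s, ¬ ((s = .upper ∧ (d = a ∧ x = tb ∨ d = -a ∧ x = tm)) ∨
      (d = b ∧ x = tm ∧ s = .lower ∨ d = -b ∧ x = mb ∧ s = .upper) ∨
      (s = .lower ∧ (d = c ∧ x = mb ∨ d = -c ∧ x = tb))) →
      D.arc d (x, s) ≠ iT ∧ D.arc d (x, s) ≠ iM ∧ D.arc d (x, s) ≠ iB := fun d x s h =>
    ⟨fun e => h (.inl (nT e)), fun e => h (.inr (.inl (nM e))), fun e => h (.inr (.inr (nB e)))⟩
  have oT := hout (-a) tb .upper (by simp [na, h₃, h₂.symm])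
  have oT' := hout a tm .upper (by simp [na.symm, h₁, h₃.symm])
  have oM := hout b mb .upper (by simp [nb.symm, h₂, h₁.symm])
  have oM' := hout (-b) tm .lower (by simp [nb, h₁, h₃.symm])
  have oB := hout c tb .lower (by simp [nc.symm, h₃, h₂.symm])
  have oB' := hout (-c) mb .lower (by simp [nc, h₂, h₁.symm])
  refine LinkDiagram.fareMultiset_le
    (fun f f' => ∀ e, e ≠ iT → e ≠ iM → e ≠ iB → f' (τ e) = f e) (fun f hf => ?_) ?_
  · rw [isColoring_iff] at hf
    obtain ⟨p, hp⟩ := hf tm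
    obtain ⟨q, hq⟩ := hf mb
    obtain ⟨r, hr⟩ := hf tb
    have e₁ : upperColor (-(ε * b)) p = upperColor (-(ε * c)) r := by
      rw [← a₃, ← (hr a).2, ← hT, eT, (hp (-a)).2, neg_mul, a₁]
    have e₂ : lowerColor (-(ε * a)) p = upperColor (-(ε * c)) q := by
      rw [← b₁, ← (hp b).1, ← hM, eM, (hq (-b)).2, neg_mul, b₂]
    have e₃ : lowerColor (-(ε * b)) q = lowerColor (-(ε * a)) r := by
      rw [← c₂, ← (hq c).1, ← hB, eB, (hr (-c)).1, neg_mul, c₃, neg_neg]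
    obtain ⟨p', q', r', ⟨i₁, i₂, i₃⟩, ⟨t₁, t₂⟩, ⟨m₁, m₂⟩, ⟨n₁, n₂⟩, hw⟩ :=
      exists_swapped_triangle_colors hφ.weight_triangle e₁ e₂ e₃
    simp only [neg_neg, neg_mul_neg] at i₁ i₂ i₃ t₁ t₂ m₁ m₂ n₁ n₂ hw
    -- Only the three sides of the triangle are recolored.
    let g : D.Semiarc → X := fun e => if e = iT then upperColor (ε * b) p' else
      if e = iM then lowerColor (ε * a) p' else if e = iB then lowerColor (ε * b) q' else f e
    have gT : g iT = upperColor (ε * b) p' := if_pos rfl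
    have gM : g iM = lowerColor (ε * a) p' := (if_neg hTM).trans (if_pos rfl)
    have gB : g iB = lowerColor (ε * b) q' :=
      (if_neg hTB).trans ((if_neg hMB).trans (if_pos rfl))
    have go : ∀ {e}, e ≠ iT → e ≠ iM → e ≠ iB → g e = f e := fun h₁ h₂ h₃ =>
      (if_neg h₁).trans ((if_neg h₂).trans (if_neg h₃))
    have gτ : ∀ e, (g ∘ τ.symm) (τ e) = g e := fun e => congrArg g (τ.symm_apply_apply e)
    have hp' : D'.HasColorsAt (g ∘ τ.symm) (κ tm) p' := by
      refine hasColorsAt_of a b ?_ ?_ ?_ ?_ <;> rw [hs]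
      · rw [M₂, gτ, go oM.1 oM.2.1 oM.2.2, (hq b).2, b₁, b₂, m₂]
      · rw [M₁, gτ, gM, b₁]
      · rw [T₄, gτ, gT, a₁]
      · rw [T₃, gτ, go oT.1 oT.2.1 oT.2.2, (hr (-a)).2, neg_mul, a₃, a₁, neg_neg, t₂]
    have hq' : D'.HasColorsAt (g ∘ τ.symm) (κ mb) q' := by
      refine hasColorsAt_of b c ?_ ?_ ?_ ?_ <;> rw [hs]
      · rw [B₂, gτ, go oB.1 oB.2.1 oB.2.2, (hr c).1, c₂, c₃, neg_neg, n₂]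
      · rw [B₁, gτ, gB, c₂]
      · rw [M₄, gτ, gM, b₂, i₂]
      · rw [M₃, gτ, go oM'.1 oM'.2.1 oM'.2.2, (hp (-b)).1, neg_mul, b₁, b₂, neg_neg, m₁]
    have hr' : D'.HasColorsAt (g ∘ τ.symm) (κ tb) r' := by
      refine hasColorsAt_of a c ?_ ?_ ?_ ?_ <;> rw [hs]
      · rw [B₄, gτ, gB, c₃, neg_neg, i₃]
      · rw [B₃, gτ, go oB'.1 oB'.2.1 oB'.2.2, (hq (-c)).1, neg_mul, c₂, c₃, neg_neg, n₁]
      · rw [T₂, gτ, go oT'.1 oT'.2.1 oT'.2.2, (hp a).2, a₁, a₃, t₁]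
      · rw [T₁, gτ, gT, a₃, neg_neg, i₁]
    have hother : ∀ x, x ≠ tm → x ≠ mb → x ≠ tb → ∀ d s,
        (g ∘ τ.symm) (D'.arc d (κ x, s)) = f (D.arc d (x, s)) := fun x x₁ x₂ x₃ d s => by
      rw [forall_arc (P := fun e' e => e' = τ e) (fun s => (ho x s x₁ x₂ x₃).1)
        (fun s => (ho x s x₁ x₂ x₃).2) d s, gτ]
      exact go (fun h => by simpa [x₁, x₃] using nT h) (fun h => by simpa [x₁, x₂] using nM h)
        (fun h => by simpa [x₂, x₃] using nB h)
    refine ⟨g ∘ τ.symm, fun e h₁ h₂ h₃ => (gτ e).trans (go h₁ h₂ h₃), ?_, ?_⟩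
    · rw [isColoring_iff]
      intro c'
      obtain ⟨x, rfl⟩ := κ.surjective c'
      by_cases x₁ : x = tm
      · exact ⟨p', x₁ ▸ hp'⟩
      by_cases x₂ : x = mb
      · exact ⟨q', x₂ ▸ hq'⟩
      by_cases x₃ : x = tb
      · exact ⟨r', x₃ ▸ hr'⟩
      obtain ⟨o, hx⟩ := hf x
      exact ⟨o, hx.congr (hs x) (hother x x₁ x₂ x₃)⟩
    · rw [totalFare_eq_sum, totalFare_eq_sum, ← Equiv.sum_comp κ, ← sub_eq_zero,
        ← Finset.sum_sub_distrib, ← Finset.sum_subset (Finset.subset_univ {tm, mb, tb})]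
      · rw [Finset.sum_insert (by simp [h₁, h₃.symm]), Finset.sum_pair h₂,
          hp.crossingFare_eq hφ, hq.crossingFare_eq hφ, hr.crossingFare_eq hφ,
          hp'.crossingFare_eq hφ, hq'.crossingFare_eq hφ, hr'.crossingFare_eq hφ, hs, hs, hs,
          s₁, s₂, s₃]
        have hε : ∀ u v : ℤˣ, ε * (ε * u * (ε * v)) = ε * u * v := fun u v => by
          rw [mul_assoc, sq, mul_left_comm, mul_assoc]
        -- In `hw` the factors `ε` cancel in pairs; multiplying by `ε` restores the signs of the
        -- crossings.
        have := congrArg ((ε : ℤ) • ·) hw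
        simp only [smul_add, smul_sub, smul_smul, ← Units.val_mul, hε] at this
        rw [← sub_eq_zero] at this
        rw [← this, Units.val_neg, neg_smul, neg_smul]
        abel
      · intro x _ hx
        simp only [Finset.mem_insert, Finset.mem_singleton, not_or] at hx
        rw [crossingFare_congr (hs x) (hother x hx.1 hx.2.1 hx.2.2), sub_self]
  · intro f₁ f₂ f' hf₁ hf₂ r₁ r₂
    rw [isColoring_iff] at hf₁ hf₂
    have hf : ∀ {e}, e ≠ iT ∧ e ≠ iM ∧ e ≠ iB → f₁ e = f₂ e := fun h =>
      (r₁ _ h.1 h.2.1 h.2.2).symm.trans (r₂ _ h.1 h.2.1 h.2.2)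
    obtain ⟨p, hp⟩ := hf₁ tm
    obtain ⟨p', hp'⟩ := hf₂ tm
    obtain ⟨r, hr⟩ := hf₁ tb
    obtain ⟨r', hr'⟩ := hf₂ tb
    -- At `tm` and `tb` each strand has one outer end, so the pairs there are determined; every side
    -- of the triangle ends at one of these crossings.
    obtain rfl : p = p' := colors_ext
      (by rw [← (hp (-b)).1, ← (hp' (-b)).1, hf oM']) (by rw [← (hp a).2, ← (hp' a).2, hf oT'])
    obtain rfl : r = r' := colors_ext
      (by rw [← (hr c).1, ← (hr' c).1, hf oB]) (by rw [← (hr (-a)).2, ← (hr' (-a)).2, hf oT])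
    funext e
    by_cases heT : e = iT
    · rw [heT, eT, (hp (-a)).2, (hp' (-a)).2]
    by_cases heM : e = iM
    · rw [heM, hM, (hp b).1, (hp' b).1]
    by_cases heB : e = iB
    · rw [heB, eB, (hr (-c)).1, (hr' (-c)).1]
    exact hf ⟨heT, heM, heB⟩

/-! ### Invariance under sequences of moves. -/

theorem ReidemeisterEquiv.fareMultiset_eq (hφ : IsFare k φ) (h : ReidemeisterEquiv D D') :
    fareMultiset k φ D = fareMultiset k φ D' := by
  induction h with
  | rel D D' h =>
    rcases h with h | h | h | h
    · exact le_antisymm h.fareMultiset_le h.symm.fareMultiset_le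
    · exact h.fareMultiset_eq hφ
    · exact h.fareMultiset_eq hφ
    · exact le_antisymm (h.fareMultiset_le hφ) (h.symm.fareMultiset_le hφ)
  | refl => rfl
  | symm _ _ _ ih => exact ih.symm
  | trans _ _ _ _ _ ih₁ ih₂ => exact ih₁.trans ih₂

end FareInvariance

end LinkDiagram

theorem theorem2 {X A : Type*} [Biquandle X] [Fintype X] [AddCommGroup A]
    (k : FareType) (φ : X × X → A) (hφ : IsFare k φ)
    (D D' : LinkDiagram) (h : LinkDiagram.ReidemeisterEquiv D D') :
    LinkDiagram.fareMultiset k φ D = LinkDiagram.fareMultiset k φ D' :=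
  h.fareMultiset_eq hφ
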